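/- For a finite simple digraph $G$ and $0\le\alpha<1$ let $A_\alpha(G)=\alpha D(G)+(1-\alpha)A(G)$, where $A(G)$ is the adjacency matrix and $D(G)$ the diagonal matrix of out-degrees, and let $\rho_\alpha(G)$ be the spectral radius of $A_\alpha(G)$. For integers $t\ge 1$ and $m\ge 2t-1$ let $\widetilde S^t_m$ be the set of integer vectors $(x_1,\dots,x_t)$ with $x_1\ge x_2\ge\dots\ge x_t\ge 1$, $\sum_i x_i=m$ and (if $t\ge 2$) $x_{t-1}\ge 2$. For vectors of the same length and the same sum, $\mathbf x$ majorizes $\mathbf y$ if for every $k$ the sum of the $k$ smallest entries of $\mathbf x$ is at most the sum of the $k$ smallest entries of $\mathbf y$. The largest element of $\widetilde S^t_m$ in this order is $\mathbf x^*(\widetilde S^t_m)=(m-2t+3,2,\dots,2,1)$ (which is to be read as $(m)$ if $t=1$), and the smallest is the balanced vector $\mathbf x_*(\widetilde S^t_m)=(q+1,\dots,q+1,q,\dots,q)$, where $m=qt+r$, $0\le r<t$, and $q+1$ occurs $r$ times. For $\mathbf K_1=(k_1,\dots,k_s)\in\widetilde S^s_{m_1}$ and $\mathbf K_2=(l_1,\dots,l_t)\in\widetilde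 S^t_{m_2}$ let $\widetilde\Theta(\mathbf K_1,\mathbf K_2)$ be the digraph consisting of two vertices $u,v$, of $s$ internally disjoint directed paths of lengths $k_1,\dots,k_s$ from $u$ to $v$, and of $t$ internally disjoint directed paths of lengths $l_1,\dots,l_t$ from $v$ to $u$ (the internal vertices of different paths being different). **Theorem.** Let $s,t\ge 1$, $m_1\ge 2s-1$, $m_2\ge 2t-1$ and $0\le\alpha<1$. Put $\xi_1=\mathbf x^*(\widetilde S^s_{m_1})$, $\xi_2=\mathbf x^*(\widetilde S^t_{m_2})$, $\eta_1=\mathbf x_*(\widetilde S^s_{m_1})$, $\eta_2=\mathbf x_*(\widetilde S^t_{m_2})$; these are indeed the largest and the smallest elements of the respective sets in the majorization order. Then for all $\mathbf K_1\in\widetilde S^s_{m_1}$ and $\mathbf K_2\in\widetilde S^t_{m_2}$, $$\rho_\alpha(\widetilde\Theta(\eta_1,\eta_2))\le\rho_\alpha(\widetilde\Theta(\mathbf K_1,\mathbf K_2))\le\rho_\alpha(\widetilde\Theta(\xi_1,\xi_2)),$$ with equality on the right if and only if $(\mathbf K_1,\mathbf K_2)=(\xi_1,\xi_2)$ and equality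 on the left if and only if $(\mathbf K_1,\mathbf K_2)=(\eta_1,\eta_2)$. That is, $\widetilde\Theta(\xi_1,\xi_2)$ and $\widetilde\Theta(\eta_1,\eta_2)$ are the unique digraphs with the maximal and the minimal $\alpha$-spectral radius, respectively, among all $\widetilde\Theta(\mathbf K_1,\mathbf K_2)$ with $\mathbf K_1\in\widetilde S^s_{m_1}$, $\mathbf K_2\in\widetilde S^t_{m_2}$. -/

import Mathlib

noncomputable section

/-! ### The α-matrix and the α-spectral radius of a digraph -/

/-- The out-degree of a vertex of a finite digraph. -/
def outDeg {V : Type*} [Fintype V] (G : Digraph V) (x : V) : ℕ := by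
  classical exact (Finset.univ.filter fun y => G.Adj x y).card

/-- The `0`-`1` adjacency matrix of a digraph: the entry at `(x, y)` is `1` iff there is an arc
from `x` to `y`. -/
def digraphAdjMatrix {V : Type*} (G : Digraph V) : Matrix V V ℝ := by
  classical exact Matrix.of fun x y => if G.Adj x y then 1 else 0

/-- `A_α(G) = α D(G) + (1 - α) A(G)`, where `D(G)` is the diagonal matrix of out-degrees. -/
def alphaMatrix {V : Type*} [Fintype V] [DecidableEq V] (α : ℝ) (G : Digraph V) :
    Matrix V V ℝ :=
  α • Matrix.diagonal (fun x => (outDeg G x : ℝ)) + (1 - α) • digraphAdjMatrix G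

/-- The α-spectral radius `ρ_α(G)`: the largest modulus of a complex eigenvalue of `A_α(G)`. -/
def alphaSpectralRadius {V : Type*} [Fintype V] [DecidableEq V] (α : ℝ) (G : Digraph V) :
    ENNReal :=
  spectralRadius ℂ ((alphaMatrix α G).map (algebraMap ℝ ℂ))

/-! ### Generalized theta digraphs -/

/-- The vertices of the generalized theta digraph: the two branch vertices (`false` is `u`, `true`
is `v`), the `K₁ i - 1` internal vertices of the `i`-th path from `u` to `v`, and the `K₂ j - 1`
internal vertices of the `j`-th path from `v` to `u`. -/
abbrev ThetaVertex {s t : ℕ} (K₁ : Fin s → ℕ) (K₂ : Fin t → ℕ) : Type :=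
  Bool ⊕ ((Σ i : Fin s, Fin (K₁ i - 1)) ⊕ (Σ j : Fin t, Fin (K₂ j - 1)))

/-- The vertex at position `r` (`0 ≤ r ≤ K₁ i`) of the `i`-th path from `u` to `v`. -/
def thetaFwd {s t : ℕ} (K₁ : Fin s → ℕ) (K₂ : Fin t → ℕ) (i : Fin s) (r : ℕ) :
    ThetaVertex K₁ K₂ :=
  if r = 0 then Sum.inl false
  else if h : r - 1 < K₁ i - 1 then Sum.inr (Sum.inl ⟨i, ⟨r - 1, h⟩⟩)
  else Sum.inl true

/-- The vertex at position `r` (`0 ≤ r ≤ K₂ j`) of the `j`-th path from `v` to `u`. -/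
def thetaBwd {s t : ℕ} (K₁ : Fin s → ℕ) (K₂ : Fin t → ℕ) (j : Fin t) (r : ℕ) :
    ThetaVertex K₁ K₂ :=
  if r = 0 then Sum.inl true
  else if h : r - 1 < K₂ j - 1 then Sum.inr (Sum.inr ⟨j, ⟨r - 1, h⟩⟩)
  else Sum.inl false

/-- The generalized theta digraph of `K₁ = (k₁, …, k_s)` and `K₂ = (l₁, …, l_t)`: two vertices `u`,
`v`, joined by `s` internally disjoint directed paths of lengths `k₁, …, k_s` from `u` to `v` and
`t` internally disjoint directed paths of lengths `l₁, …, l_t` from `v` to `u`. -/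
def thetaDigraph {s t : ℕ} (K₁ : Fin s → ℕ) (K₂ : Fin t → ℕ) : Digraph (ThetaVertex K₁ K₂) where
  Adj x y :=
    (∃ i : Fin s, ∃ r < K₁ i, x = thetaFwd K₁ K₂ i r ∧ y = thetaFwd K₁ K₂ i (r + 1)) ∨
    (∃ j : Fin t, ∃ r < K₂ j, x = thetaBwd K₁ K₂ j r ∧ y = thetaBwd K₁ K₂ j (r + 1))

/-- The admissible path-length vectors: `x₁ ≥ x₂ ≥ … ≥ x_t ≥ 1` with sum `m` and `x_{t-1} ≥ 2`
(no condition of the last kind if `t = 1`). The coordinate `x_{i+1}` is `x i` here. -/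
def pathLengthVectors (t m : ℕ) : Set (Fin t → ℕ) :=
  {x | Antitone x ∧ (∀ i, 1 ≤ x i) ∧ ∑ i, x i = m ∧ ∀ i : Fin t, (i : ℕ) + 2 = t → 2 ≤ x i}

/-! ### Majorization -/

/-- `x` majorizes `y`: the sums are equal and, for each `k`, the sum of the `k` smallest entries of
`x` is at most the sum of the `k` smallest entries of `y`
(`x ∘ Tuple.sort x` lists the entries of `x` in ascending order). -/
def Majorizes {p : ℕ} (x y : Fin p → ℕ) : Prop :=
  (∀ k ≤ p, ∑ i ∈ Finset.univ.filter (fun i : Fin p => (i : ℕ) < k), x (Tuple.sort x i) ≤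
      ∑ i ∈ Finset.univ.filter (fun i : Fin p => (i : ℕ) < k), y (Tuple.sort y i)) ∧
    ∑ i, x i = ∑ i, y i

/-- `x` is the largest element of `S` in the majorization order. -/
def IsMajGreatest {p : ℕ} (S : Set (Fin p → ℕ)) (x : Fin p → ℕ) : Prop :=
  x ∈ S ∧ ∀ y ∈ S, Majorizes x y

/-- `x` is the smallest element of `S` in the majorization order. -/
def IsMajLeast {p : ℕ} (S : Set (Fin p → ℕ)) (x : Fin p → ℕ) : Prop :=
  x ∈ S ∧ ∀ y ∈ S, Majorizes y x

/-- The vector `(m - 2t + 3, 2, …, 2, 1)` of length `t`, which is `(m)` for `t = 1`. -/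
def majMaxVec (t m : ℕ) : Fin t → ℕ := fun i =>
  if t = 1 then m
  else if (i : ℕ) = 0 then m + 3 - 2 * t
  else if (i : ℕ) + 1 = t then 1
  else 2

/-- The balanced vector `(q + 1, …, q + 1, q, …, q)` of length `t`, where `m = q t + r` with
`0 ≤ r < t`, and `q + 1` occurs `r` times. -/
def majMinVec (t m : ℕ) : Fin t → ℕ := fun i =>
  m / t + if (i : ℕ) < m % t then 1 else 0

end

/-! A positive eigenvector of a nonnegative matrix belongs to the spectral radius, so it suffices to
exhibit one. An internal vertex of a path has out-degree 1, so an eigenvector for `ρ` is multiplied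
by `c = (1 - α)/(ρ - α)` at each step backwards. With `P = ∑ c ^ (kᵢ - 1)` and `Q = ∑ c ^ (lⱼ - 1)`,
the equations at `u` and `v` are `(ρ - sα) z_u = (1 - α) P z_v` and `(ρ - tα) z_v = (1 - α) Q z_u`.
They have a positive solution when `(ρ - sα)(ρ - tα) = (1 - α)² P Q` with positive factors on the
left. Hence every zero of `thetaChar` in `ρ ≥ max(1, sα, tα)` is the α-spectral radius; existence
comes from the intermediate value theorem, and uniqueness of the zero needs no separate proof.

For `ρ ≥ 1` one has `0 < c ≤ 1`, and `x ↦ ∑ c ^ xᵢ` is Schur-convex. If `K` majorizes `L`, then at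
the zero of `K` the function for `L` is nonnegative, so `L` has a zero that is no larger
(`alphaSpectralRadius_le_of_majorizes`). Equality forces equal products `P Q`, hence equal vectors
if `c < 1`. The case `c = 1` occurs only for `s = t = 1`, where the sums determine the vectors. -/

/-! ### Spectral radius from a positive eigenvector -/

/-- A nonnegative real matrix with a positive eigenvector for `ρ` has spectral radius `ρ`. -/
theorem spectralRadius_eq_of_pos_eigenvector {V : Type*} [Fintype V] [DecidableEq V] [Nonempty V]
    (A : Matrix V V ℝ) (hA : ∀ i j, 0 ≤ A i j) (z : V → ℝ) (hz : ∀ i, 0 < z i) (ρ : ℝ)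
    (hρ : 0 ≤ ρ) (h : ∀ i, ∑ j, A i j * z j = ρ * z i) :
    spectralRadius ℂ (A.map (algebraMap ℝ ℂ)) = ENNReal.ofReal ρ := by
  have key : ∀ μ : ℂ, μ ∈ spectrum ℂ (A.map (algebraMap ℝ ℂ)) ↔
      ∃ w : V → ℂ, w ≠ 0 ∧ ∀ i, ∑ j, (A i j : ℂ) * w j = μ * w i := by
    intro μ
    rw [← Matrix.spectrum_toLin', ← Module.End.hasEigenvalue_iff_mem_spectrum]
    constructor
    · intro hμ
      obtain ⟨w, hw⟩ := hμ.exists_hasEigenvector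
      refine ⟨w, hw.2, fun i => ?_⟩
      have := congrFun hw.apply_eq_smul i
      simpa [Matrix.toLin'_apply, Matrix.mulVec, dotProduct] using this
    · rintro ⟨w, hw0, hw⟩
      refine Module.End.hasEigenvalue_of_hasEigenvector (x := w)
        ⟨Module.End.mem_eigenspace_iff.2 ?_, hw0⟩
      ext i
      simpa [Matrix.toLin'_apply, Matrix.mulVec, dotProduct] using hw i
  apply le_antisymm
  · refine iSup₂_le fun μ hμ => ?_
    obtain ⟨w, hw0, hw⟩ := (key μ).1 hμ
    rw [← enorm_eq_nnnorm, ← ofReal_norm]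
    apply ENNReal.ofReal_le_ofReal
    -- At an index maximizing `‖w i‖ / z i`, the eigenvalue equation bounds `‖μ‖` by `ρ`.
    obtain ⟨i, hi⟩ := Finite.exists_max fun i => ‖w i‖ / z i
    have hM : ∀ j, ‖w j‖ ≤ ‖w i‖ / z i * z j := fun j => (div_le_iff₀ (hz j)).1 (hi j)
    have hwi : 0 < ‖w i‖ := by
      by_contra hcon
      have h0 : ‖w i‖ = 0 := le_antisymm (not_lt.1 hcon) (norm_nonneg _)
      refine hw0 (funext fun j => ?_)
      have := hM j
      rw [h0] at this
      simpa using this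
    have h1 : ‖μ‖ * ‖w i‖ ≤ ρ * ‖w i‖ := by
      calc ‖μ‖ * ‖w i‖ = ‖∑ j, (A i j : ℂ) * w j‖ := by rw [hw i, norm_mul]
        _ ≤ ∑ j, ‖(A i j : ℂ) * w j‖ := norm_sum_le _ _
        _ ≤ ∑ j, ‖w i‖ / z i * (A i j * z j) := by
            refine Finset.sum_le_sum fun j _ => ?_
            rw [norm_mul, Complex.norm_real, Real.norm_of_nonneg (hA i j)]
            nlinarith [mul_le_mul_of_nonneg_left (hM j) (hA i j)]
        _ = ρ * ‖w i‖ := by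
            rw [← Finset.mul_sum, h i]
            field_simp [(hz i).ne']
    exact le_of_mul_le_mul_right h1 hwi
  · have hmem : (ρ : ℂ) ∈ spectrum ℂ (A.map (algebraMap ℝ ℂ)) := by
      refine (key _).2 ⟨fun i => (z i : ℂ), fun h0 => ?_, fun i => ?_⟩
      · obtain ⟨i⟩ := ‹Nonempty V›
        exact (hz i).ne' (Complex.ofReal_eq_zero.1 (congrFun h0 i))
      · have := congrArg Complex.ofReal (h i)
        push_cast at this
        exact this
    have := le_iSup₂ (f := fun (k : ℂ) (_ : k ∈ spectrum ℂ (A.map (algebraMap ℝ ℂ))) =>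
      (‖k‖₊ : ENNReal)) (ρ : ℂ) hmem
    refine le_trans (le_of_eq ?_) this
    rw [← enorm_eq_nnnorm, ← ofReal_norm, Complex.norm_real, Real.norm_of_nonneg hρ]

/-- The row of `A_α(G)` at `x`, applied to `z`, when `nb` enumerates the out-neighbours of `x`. -/
theorem alphaMatrix_row_sum {V ι : Type*} [Fintype V] [DecidableEq V] [Fintype ι]
    (α : ℝ) (G : Digraph V) (x : V) (nb : ι → V) (hinj : Function.Injective nb)
    (hnb : ∀ y, G.Adj x y ↔ ∃ i, y = nb i) (z : V → ℝ) :
    ∑ y, alphaMatrix α G x y * z y =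
      α * Fintype.card ι * z x + (1 - α) * ∑ i, z (nb i) := by
  classical
  have hset : (Finset.univ.filter fun y => G.Adj x y) = Finset.univ.image nb := by
    ext y
    simp [hnb, eq_comm]
  have hdeg : outDeg G x = Fintype.card ι := by
    have : outDeg G x = (Finset.univ.filter fun y => G.Adj x y).card := by
      unfold outDeg
      congr
    rw [this, hset, Finset.card_image_of_injective _ hinj, Finset.card_univ]
  have hsum : ∑ y, digraphAdjMatrix G x y * z y = ∑ i, z (nb i) := by
    have h1 : ∑ y, digraphAdjMatrix G x y * z y =
        ∑ y ∈ Finset.univ.filter (fun y => G.Adj x y), z y := by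
      rw [Finset.sum_filter]
      refine Finset.sum_congr rfl fun y _ => ?_
      by_cases hxy : G.Adj x y <;> simp [digraphAdjMatrix, hxy]
    rw [h1, hset, Finset.sum_image fun a _ b _ hab => hinj hab]
  simp only [alphaMatrix, Matrix.add_apply, Matrix.smul_apply, smul_eq_mul, add_mul,
    Finset.sum_add_distrib]
  congr 1
  · rw [Finset.sum_eq_single x]
    · simp [hdeg]
    · intro y _ hy
      simp [Matrix.diagonal_apply_ne _ hy.symm]
    · simp
  · simp only [mul_assoc]
    rw [← Finset.mul_sum, hsum]

theorem alphaMatrix_nonneg {V : Type*} [Fintype V] [DecidableEq V] (α : ℝ) (h0 : 0 ≤ α)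
    (h1 : α ≤ 1) (G : Digraph V) (x y : V) : 0 ≤ alphaMatrix α G x y := by
  classical
  simp only [alphaMatrix, Matrix.add_apply, Matrix.smul_apply, smul_eq_mul]
  refine add_nonneg (mul_nonneg h0 ?_) (mul_nonneg (by linarith) ?_)
  · rw [Matrix.diagonal_apply]
    split_ifs <;> positivity
  · simp only [digraphAdjMatrix, Matrix.of_apply]
    split_ifs <;> norm_num

/-! ### Out-neighbours in theta digraphs and the candidate eigenvector -/

section ThetaNeighbours

variable {s t : ℕ} (K₁ : Fin s → ℕ) (K₂ : Fin t → ℕ)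

theorem thetaFwd_cases (i : Fin s) {r : ℕ} (hr : r < K₁ i) :
    (r = 0 ∧ thetaFwd K₁ K₂ i r = Sum.inl false) ∨
      ∃ a : Fin (K₁ i - 1), r = a + 1 ∧ thetaFwd K₁ K₂ i r = Sum.inr (Sum.inl ⟨i, a⟩) := by
  by_cases h0 : r = 0
  · exact Or.inl ⟨h0, by simp [thetaFwd, h0]⟩
  · have h : r - 1 < K₁ i - 1 := by omega
    exact Or.inr ⟨⟨r - 1, h⟩, by simp only; omega, by simp [thetaFwd, h0, h]⟩

theorem thetaBwd_cases (j : Fin t) {r : ℕ} (hr : r < K₂ j) :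
    (r = 0 ∧ thetaBwd K₁ K₂ j r = Sum.inl true) ∨
      ∃ a : Fin (K₂ j - 1), r = a + 1 ∧ thetaBwd K₁ K₂ j r = Sum.inr (Sum.inr ⟨j, a⟩) := by
  by_cases h0 : r = 0
  · exact Or.inl ⟨h0, by simp [thetaBwd, h0]⟩
  · have h : r - 1 < K₂ j - 1 := by omega
    exact Or.inr ⟨⟨r - 1, h⟩, by simp only; omega, by simp [thetaBwd, h0, h]⟩

theorem thetaFwd_internal (i : Fin s) (a : Fin (K₁ i - 1)) :
    thetaFwd K₁ K₂ i (a + 1) = Sum.inr (Sum.inl ⟨i, a⟩) := by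
  simp [thetaFwd]

theorem thetaBwd_internal (j : Fin t) (a : Fin (K₂ j - 1)) :
    thetaBwd K₁ K₂ j (a + 1) = Sum.inr (Sum.inr ⟨j, a⟩) := by
  simp [thetaBwd]

theorem thetaDigraph_adj_source (h₁ : ∀ i, 1 ≤ K₁ i) (y : ThetaVertex K₁ K₂) :
    (thetaDigraph K₁ K₂).Adj (Sum.inl false) y ↔ ∃ i, y = thetaFwd K₁ K₂ i 1 := by
  constructor
  · rintro (⟨i, r, hr, hx, hy⟩ | ⟨j, r, hr, hx, hy⟩)
    · obtain ⟨rfl, h⟩ | ⟨a, -, h⟩ := thetaFwd_cases K₁ K₂ i hr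
      · exact ⟨i, hy⟩
      · simp [h] at hx
    · obtain ⟨-, h⟩ | ⟨a, -, h⟩ := thetaBwd_cases K₁ K₂ j hr <;> simp [h] at hx
  · rintro ⟨i, rfl⟩
    exact Or.inl ⟨i, 0, h₁ i, by simp [thetaFwd], rfl⟩

theorem thetaDigraph_adj_sink (h₂ : ∀ j, 1 ≤ K₂ j) (y : ThetaVertex K₁ K₂) :
    (thetaDigraph K₁ K₂).Adj (Sum.inl true) y ↔ ∃ j, y = thetaBwd K₁ K₂ j 1 := by
  constructor
  · rintro (⟨i, r, hr, hx, hy⟩ | ⟨j, r, hr, hx, hy⟩)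
    · obtain ⟨-, h⟩ | ⟨a, -, h⟩ := thetaFwd_cases K₁ K₂ i hr <;> simp [h] at hx
    · obtain ⟨rfl, h⟩ | ⟨a, -, h⟩ := thetaBwd_cases K₁ K₂ j hr
      · exact ⟨j, hy⟩
      · simp [h] at hx
  · rintro ⟨j, rfl⟩
    exact Or.inr ⟨j, 0, h₂ j, by simp [thetaBwd], rfl⟩

theorem thetaDigraph_adj_fwd (i : Fin s) (a : Fin (K₁ i - 1)) (y : ThetaVertex K₁ K₂) :
    (thetaDigraph K₁ K₂).Adj (Sum.inr (Sum.inl ⟨i, a⟩)) y ↔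
      y = thetaFwd K₁ K₂ i (a + 1 + 1) := by
  constructor
  · rintro (⟨i', r, hr, hx, hy⟩ | ⟨j, r, hr, hx, hy⟩)
    · obtain ⟨-, h⟩ | ⟨b, rfl, h⟩ := thetaFwd_cases K₁ K₂ i' hr
      · simp [h] at hx
      · rw [h] at hx
        have hs := Sum.inl.inj (Sum.inr.inj hx)
        obtain ⟨rfl, hab⟩ := Sigma.mk.inj_iff.1 hs
        rw [eq_of_heq hab, hy]
    · obtain ⟨-, h⟩ | ⟨b, -, h⟩ := thetaBwd_cases K₁ K₂ j hr <;> simp [h] at hx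
  · rintro rfl
    exact Or.inl ⟨i, a + 1, by omega, (thetaFwd_internal K₁ K₂ i a).symm, rfl⟩

theorem thetaDigraph_adj_bwd (j : Fin t) (a : Fin (K₂ j - 1)) (y : ThetaVertex K₁ K₂) :
    (thetaDigraph K₁ K₂).Adj (Sum.inr (Sum.inr ⟨j, a⟩)) y ↔
      y = thetaBwd K₁ K₂ j (a + 1 + 1) := by
  constructor
  · rintro (⟨i, r, hr, hx, hy⟩ | ⟨j', r, hr, hx, hy⟩)
    · obtain ⟨-, h⟩ | ⟨b, -, h⟩ := thetaFwd_cases K₁ K₂ i hr <;> simp [h] at hx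
    · obtain ⟨-, h⟩ | ⟨b, rfl, h⟩ := thetaBwd_cases K₁ K₂ j' hr
      · simp [h] at hx
      · rw [h] at hx
        have hs := Sum.inr.inj (Sum.inr.inj hx)
        obtain ⟨rfl, hab⟩ := Sigma.mk.inj_iff.1 hs
        rw [eq_of_heq hab, hy]
  · rintro rfl
    exact Or.inr ⟨j, a + 1, by omega, (thetaBwd_internal K₁ K₂ j a).symm, rfl⟩

/-- Paths are internally disjoint, so two of them can share the vertex after `u` only if both are
the single arc `uv`. Injectivity makes the out-degree of `u` equal to `s`. -/
theorem thetaFwd_one_injective (h₁ : ∀ i, 1 ≤ K₁ i)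
    (hinj : ∀ i j, K₁ i = 1 → K₁ j = 1 → i = j) :
    Function.Injective fun i => thetaFwd K₁ K₂ i 1 := by
  intro i j hij
  have hi := h₁ i
  have hj := h₁ j
  by_cases h : 0 < K₁ i - 1 <;> by_cases h' : 0 < K₁ j - 1 <;>
    simp [thetaFwd, h, h'] at hij
  · exact hij.1
  · exact hinj i j (by omega) (by omega)

theorem thetaBwd_one_injective (h₂ : ∀ i, 1 ≤ K₂ i)
    (hinj : ∀ i j, K₂ i = 1 → K₂ j = 1 → i = j) :
    Function.Injective fun j => thetaBwd K₁ K₂ j 1 := by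
  intro i j hij
  have hi := h₂ i
  have hj := h₂ j
  by_cases h : 0 < K₂ i - 1 <;> by_cases h' : 0 < K₂ j - 1 <;>
    simp [thetaBwd, h, h'] at hij
  · exact hij.1
  · exact hinj i j (by omega) (by omega)

/-- The vector with values `zu`, `zv` at the branch vertices that is multiplied by `c` at each
step backwards along a path. -/
noncomputable def thetaVec (c zu zv : ℝ) : ThetaVertex K₁ K₂ → ℝ
  | Sum.inl false => zu
  | Sum.inl true => zv
  | Sum.inr (Sum.inl ⟨i, a⟩) => c ^ (K₁ i - 1 - a) * zv
  | Sum.inr (Sum.inr ⟨j, a⟩) => c ^ (K₂ j - 1 - a) * zu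

theorem thetaVec_source (c zu zv : ℝ) : thetaVec K₁ K₂ c zu zv (Sum.inl false) = zu := rfl

theorem thetaVec_sink (c zu zv : ℝ) : thetaVec K₁ K₂ c zu zv (Sum.inl true) = zv := rfl

theorem thetaVec_fwd_internal (c zu zv : ℝ) (i : Fin s) (a : Fin (K₁ i - 1)) :
    thetaVec K₁ K₂ c zu zv (Sum.inr (Sum.inl ⟨i, a⟩)) = c ^ (K₁ i - 1 - a) * zv := rfl

theorem thetaVec_bwd_internal (c zu zv : ℝ) (j : Fin t) (a : Fin (K₂ j - 1)) :
    thetaVec K₁ K₂ c zu zv (Sum.inr (Sum.inr ⟨j, a⟩)) = c ^ (K₂ j - 1 - a) * zu := rfl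

theorem thetaVec_fwd (c zu zv : ℝ) (i : Fin s) {r : ℕ} :
    thetaVec K₁ K₂ c zu zv (thetaFwd K₁ K₂ i (r + 1)) = c ^ (K₁ i - 1 - r) * zv := by
  by_cases h : r < K₁ i - 1
  · simp [thetaFwd, h, thetaVec]
  · have h0 : K₁ i - 1 - r = 0 := by omega
    simp [thetaFwd, h, thetaVec, h0]

theorem thetaVec_bwd (c zu zv : ℝ) (j : Fin t) {r : ℕ} :
    thetaVec K₁ K₂ c zu zv (thetaBwd K₁ K₂ j (r + 1)) = c ^ (K₂ j - 1 - r) * zu := by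
  by_cases h : r < K₂ j - 1
  · simp [thetaBwd, h, thetaVec]
  · have h0 : K₂ j - 1 - r = 0 := by omega
    simp [thetaBwd, h, thetaVec, h0]

theorem thetaVec_pos {c zu zv : ℝ} (hc : 0 < c) (hu : 0 < zu) (hv : 0 < zv) :
    ∀ x, 0 < thetaVec K₁ K₂ c zu zv x
  | Sum.inl false => hu
  | Sum.inl true => hv
  | Sum.inr (Sum.inl ⟨_, _⟩) => mul_pos (pow_pos hc _) hv
  | Sum.inr (Sum.inr ⟨_, _⟩) => mul_pos (pow_pos hc _) hu

end ThetaNeighbours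

/-! ### The characteristic equation -/

/-- The function whose largest zero is the α-spectral radius of the theta digraph. -/
noncomputable def thetaChar {s t : ℕ} (α : ℝ) (K₁ : Fin s → ℕ) (K₂ : Fin t → ℕ) (ρ : ℝ) : ℝ :=
  (ρ - s * α) * (ρ - t * α) - (1 - α) ^ 2 *
    ((∑ i, ((1 - α) / (ρ - α)) ^ (K₁ i - 1)) * ∑ j, ((1 - α) / (ρ - α)) ^ (K₂ j - 1))

theorem alphaSpectralRadius_eq_of_thetaChar_eq_zero {s t : ℕ} (hs : 1 ≤ s) (ht : 1 ≤ t) {α : ℝ}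
    (hα₀ : 0 ≤ α) (hα₁ : α < 1) {K₁ : Fin s → ℕ} {K₂ : Fin t → ℕ}
    (h₁ : ∀ i, 1 ≤ K₁ i) (h₂ : ∀ j, 1 ≤ K₂ j)
    (hinj₁ : ∀ i j, K₁ i = 1 → K₁ j = 1 → i = j) (hinj₂ : ∀ i j, K₂ i = 1 → K₂ j = 1 → i = j)
    {ρ : ℝ} (hρ : 1 ≤ ρ) (hρt : t * α ≤ ρ) (hroot : thetaChar α K₁ K₂ ρ = 0) :
    alphaSpectralRadius α (thetaDigraph K₁ K₂) = ENNReal.ofReal ρ := by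
  have : Nonempty (Fin s) := ⟨⟨0, hs⟩⟩
  have : Nonempty (Fin t) := ⟨⟨0, ht⟩⟩
  have hα : 0 < 1 - α := by linarith
  have hρα : 0 < ρ - α := by linarith
  unfold thetaChar at hroot
  obtain ⟨c, hc_def⟩ : ∃ c, c = (1 - α) / (ρ - α) := ⟨_, rfl⟩
  rw [← hc_def] at hroot
  have hc : 0 < c := hc_def ▸ div_pos hα hρα
  have hcα : (1 - α) = c * (ρ - α) := by rw [hc_def]; field_simp
  set P := ∑ i, c ^ (K₁ i - 1) with hP_def
  set Q := ∑ j, c ^ (K₂ j - 1) with hQ_def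
  have hP : 0 < P := Finset.sum_pos (fun i _ => pow_pos hc _) Finset.univ_nonempty
  have hQ : 0 < Q := Finset.sum_pos (fun i _ => pow_pos hc _) Finset.univ_nonempty
  have hprod : (ρ - s * α) * (ρ - t * α) = (1 - α) ^ 2 * (P * Q) := by linarith
  have hpp : 0 < (ρ - s * α) * (ρ - t * α) := hprod ▸ mul_pos (pow_pos hα 2) (mul_pos hP hQ)
  -- The product is positive and its second factor nonnegative, so the first factor is positive.
  have hps : 0 < ρ - s * α :=
    pos_of_mul_pos_left hpp (sub_nonneg.2 hρt)
  -- With these values at `u` and `v` the equation at `u` is an identity, and the one at `v` is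
  -- `hprod`.
  refine spectralRadius_eq_of_pos_eigenvector _
    (alphaMatrix_nonneg α hα₀ hα₁.le _) (thetaVec K₁ K₂ c ((1 - α) * P) (ρ - s * α))
    (thetaVec_pos K₁ K₂ hc (mul_pos hα hP) hps) ρ (by linarith) ?_
  rintro ((_ | _) | (⟨i, a⟩ | ⟨j, a⟩))
  · rw [alphaMatrix_row_sum α _ _ _ (thetaFwd_one_injective K₁ K₂ h₁ hinj₁)
      (thetaDigraph_adj_source K₁ K₂ h₁)]
    have := fun i => thetaVec_fwd K₁ K₂ c ((1 - α) * P) (ρ - s * α) i (r := 0)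
    simp only [zero_add, Nat.sub_zero] at this
    simp only [this, ← Finset.sum_mul, ← hP_def, Fintype.card_fin, thetaVec_source]
    ring
  · rw [alphaMatrix_row_sum α _ _ _ (thetaBwd_one_injective K₁ K₂ h₂ hinj₂)
      (thetaDigraph_adj_sink K₁ K₂ h₂)]
    have := fun j => thetaVec_bwd K₁ K₂ c ((1 - α) * P) (ρ - s * α) j (r := 0)
    simp only [zero_add, Nat.sub_zero] at this
    simp only [this, ← Finset.sum_mul, ← hQ_def, Fintype.card_fin, thetaVec_sink]
    linear_combination -hprod
  · rw [alphaMatrix_row_sum α _ _ (fun _ : Unit => thetaFwd K₁ K₂ i (a + 1 + 1))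
      (Function.injective_of_subsingleton _) (by simpa using thetaDigraph_adj_fwd K₁ K₂ i a)]
    have ha : K₁ i - 1 - a = (K₁ i - 1 - (a + 1)) + 1 := by omega
    simp only [thetaVec_fwd, thetaVec_fwd_internal, Fintype.card_unit, Finset.univ_unique,
      Finset.sum_const, Finset.card_singleton, one_smul, Nat.cast_one]
    rw [ha, pow_succ]
    linear_combination (c ^ (K₁ i - 1 - (a + 1)) * (ρ - s * α)) * hcα
  · rw [alphaMatrix_row_sum α _ _ (fun _ : Unit => thetaBwd K₁ K₂ j (a + 1 + 1))
      (Function.injective_of_subsingleton _) (by simpa using thetaDigraph_adj_bwd K₁ K₂ j a)]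
    have ha : K₂ j - 1 - a = (K₂ j - 1 - (a + 1)) + 1 := by omega
    simp only [thetaVec_bwd, thetaVec_bwd_internal, Fintype.card_unit, Finset.univ_unique,
      Finset.sum_const, Finset.card_singleton, one_smul, Nat.cast_one]
    rw [ha, pow_succ]
    linear_combination (c ^ (K₂ j - 1 - (a + 1)) * ((1 - α) * P)) * hcα

/-! ### Majorization and the extremal vectors -/

/-- The sum of the last `k` coordinates. -/
def suffixSum {p : ℕ} (x : Fin p → ℕ) (k : ℕ) : ℕ :=
  ∑ i ∈ Finset.univ.filter (fun i : Fin p => (i : ℕ) < k), x i.rev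

theorem suffixSum_self {p : ℕ} (x : Fin p → ℕ) : suffixSum x p = ∑ i, x i := by
  unfold suffixSum
  rw [Finset.filter_true_of_mem fun i _ => i.2]
  exact Equiv.sum_comp Fin.revPerm x

/-- With ties `Tuple.sort x` need not be the reversal, but the monotone rearrangement is unique, so
the values agree. -/
theorem Antitone.apply_sort {p : ℕ} {x : Fin p → ℕ} (hx : Antitone x) (i : Fin p) :
    x (Tuple.sort x i) = x i.rev := by
  have h : x ∘ Fin.revPerm = x ∘ Tuple.sort x :=
    Tuple.comp_sort_eq_comp_iff_monotone.2 fun a b hab => hx (Fin.rev_le_rev.2 hab)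
  exact (congrFun h i).symm

theorem majorizes_iff_suffixSum {p : ℕ} {x y : Fin p → ℕ} (hx : Antitone x) (hy : Antitone y) :
    Majorizes x y ↔ (∀ k ≤ p, suffixSum x k ≤ suffixSum y k) ∧ ∑ i, x i = ∑ i, y i := by
  simp only [Majorizes, suffixSum, hx.apply_sort, hy.apply_sort]

/-- Every coordinate but the last is at least `2`. -/
theorem two_le_of_mem {t m : ℕ} {x : Fin t → ℕ} (hx : x ∈ pathLengthVectors t m) (i : Fin t)
    (hi : (i : ℕ) + 1 < t) : 2 ≤ x i :=
  (hx.2.2.2 ⟨t - 2, by omega⟩ (by simp only; omega)).trans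
    (hx.1 (Fin.le_def.2 (by simp only; omega)))

theorem majMaxVec_mem {t m : ℕ} (ht : 1 ≤ t) (hm : 2 * t - 1 ≤ m) :
    majMaxVec t m ∈ pathLengthVectors t m := by
  refine ⟨fun i j hij => ?_, fun i => ?_, ?_, fun i hi => ?_⟩
  · have hij' := Fin.le_def.1 hij
    have := j.2
    simp only [majMaxVec]
    split_ifs <;> omega
  · have := i.2
    simp only [majMaxVec]
    split_ifs <;> omega
  · obtain _ | _ | n := t
    · omega
    · simp [majMaxVec]
    · rw [Fin.sum_univ_succ, Fin.sum_univ_castSucc]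
      have h : ∀ i : Fin n, majMaxVec (n + 2) m i.castSucc.succ = 2 := by
        intro i
        have := i.2
        have hv : (i.castSucc.succ : ℕ) = i + 1 := rfl
        rw [majMaxVec, if_neg (by omega), if_neg (by omega), if_neg (by omega)]
      simp only [h]
      simp [majMaxVec]
      omega
  · simp only [majMaxVec]
    split_ifs <;> omega

theorem majMinVec_mem {t m : ℕ} (ht : 1 ≤ t) (hm : 2 * t - 1 ≤ m) :
    majMinVec t m ∈ pathLengthVectors t m := by
  have hq : 1 ≤ m / t := (Nat.one_le_div_iff ht).2 (by omega)
  have hdm := Nat.div_add_mod m t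
  have hlt := Nat.mod_lt m ht
  refine ⟨fun i j hij => ?_, fun i => ?_, ?_, fun i hi => ?_⟩
  · have hij' := Fin.le_def.1 hij
    simp only [majMinVec]
    split_ifs <;> omega
  · simp only [majMinVec]
    omega
  · simp only [majMinVec, Finset.sum_add_distrib]
    have hc : (∑ i : Fin t, if (i : ℕ) < m % t then 1 else 0) = m % t := by
      rw [Fin.sum_univ_eq_sum_range (fun i => if i < m % t then 1 else 0), ← Finset.sum_filter]
      have : (Finset.range t).filter (fun i => i < m % t) = Finset.range (m % t) := by
        ext i
        simp only [Finset.mem_filter, Finset.mem_range]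
        omega
      simp [this]
    rw [hc]
    simpa using hdm
  · simp only [majMinVec]
    by_cases h2 : 2 ≤ m / t
    · omega
    -- Quotient 1 leaves remainder `m - t ≥ t - 1`, so the penultimate entry is among those raised
    -- to 2.
    · have h1 : m / t = 1 := by omega
      rw [h1] at hdm ⊢
      rw [if_pos (by omega)]

/-- Apart from the first coordinate, every entry of `majMaxVec` is the least one allowed, so proper
suffix sums compare termwise. -/
theorem isMajGreatest_majMaxVec {t m : ℕ} (ht : 1 ≤ t) (hm : 2 * t - 1 ≤ m) :
    IsMajGreatest (pathLengthVectors t m) (majMaxVec t m) := by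
  have hmem := majMaxVec_mem ht hm
  refine ⟨hmem, fun y hy => (majorizes_iff_suffixSum hmem.1 hy.1).2
    ⟨fun k hk => ?_, hmem.2.2.1.trans hy.2.2.1.symm⟩⟩
  obtain rfl | hkt := hk.eq_or_lt
  · rw [suffixSum_self, suffixSum_self, hmem.2.2.1, hy.2.2.1]
  · refine Finset.sum_le_sum fun i hi => ?_
    have hik : (i : ℕ) < k := (Finset.mem_filter.1 hi).2
    have h1 := hy.2.1 i.rev
    have h2 := two_le_of_mem hy i.rev
    rw [Fin.val_rev] at h2
    simp only [majMaxVec, Fin.val_rev]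
    split_ifs <;> omega

/-- If a suffix sum of `x` were too large, some entry in that suffix would be at least `q + 1`. All
earlier entries of `x` would then be at least `q + 1` too, and the total would exceed `m`. -/
theorem isMajLeast_majMinVec {t m : ℕ} (ht : 1 ≤ t) (hm : 2 * t - 1 ≤ m) :
    IsMajLeast (pathLengthVectors t m) (majMinVec t m) := by
  have hmem := majMinVec_mem ht hm
  refine ⟨hmem, fun x hx => (majorizes_iff_suffixSum hx.1 hmem.1).2
    ⟨fun k hk => ?_, hx.2.2.1.trans hmem.2.2.1.symm⟩⟩
  by_contra! hlt
  obtain ⟨i, hi, hxi⟩ := Finset.exists_lt_of_sum_lt hlt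
  have hik : (i : ℕ) < k := (Finset.mem_filter.1 hi).2
  have hrest : ∑ j ∈ Finset.univ.filter (fun j : Fin t => ¬ (j : ℕ) < k), majMinVec t m j.rev ≤
      ∑ j ∈ Finset.univ.filter (fun j : Fin t => ¬ (j : ℕ) < k), x j.rev := by
    refine Finset.sum_le_sum fun j hj => ?_
    have hjk : ¬ (j : ℕ) < k := (Finset.mem_filter.1 hj).2
    have hmono : x i.rev ≤ x j.rev := hx.1 (Fin.rev_le_rev.2 (Fin.le_def.2 (by omega)))
    simp only [majMinVec] at hxi ⊢
    split_ifs at hxi ⊢ <;> omega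
  have hx' := Finset.sum_filter_add_sum_filter_not Finset.univ (fun j : Fin t => (j : ℕ) < k)
    fun j => x j.rev
  have hy' := Finset.sum_filter_add_sum_filter_not Finset.univ (fun j : Fin t => (j : ℕ) < k)
    fun j => majMinVec t m j.rev
  have ex : ∑ j : Fin t, x j.rev = m := (Equiv.sum_comp Fin.revPerm x).trans hx.2.2.1
  have ey : ∑ j : Fin t, majMinVec t m j.rev = m :=
    (Equiv.sum_comp Fin.revPerm (majMinVec t m)).trans hmem.2.2.1
  simp only [suffixSum] at hlt
  omega

/-! ### Schur-convexity of power sums -/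

/-- Summation by parts: a monotone weight bounded above by `D`, against a sequence with
nonpositive partial sums. -/
theorem mul_sum_le_sum_mul_of_partial_sums_nonpos {p : ℕ} (d a : Fin p → ℝ) (hd : Monotone d)
    (ha : ∀ k ≤ p, ∑ i ∈ Finset.univ.filter (fun i : Fin p => (i : ℕ) < k), a i ≤ 0) :
    ∀ k ≤ p, ∀ D : ℝ, (∀ i : Fin p, (i : ℕ) < k → d i ≤ D) →
      D * ∑ i ∈ Finset.univ.filter (fun i : Fin p => (i : ℕ) < k), a i ≤
        ∑ i ∈ Finset.univ.filter (fun i : Fin p => (i : ℕ) < k), d i * a i := by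
  intro k
  induction k with
  | zero => intro _ D _; simp
  | succ k ih =>
    intro hk D hD
    have hins : Finset.univ.filter (fun i : Fin p => (i : ℕ) < k + 1) =
        insert ⟨k, hk⟩ (Finset.univ.filter (fun i : Fin p => (i : ℕ) < k)) := by
      ext i
      simp only [Finset.mem_filter, Finset.mem_univ, true_and, Finset.mem_insert, Fin.ext_iff]
      omega
    have hA := ha (k + 1) hk
    -- Replacing `D` by `d k` only increases its product with the nonpositive new partial sum; `d k`
    -- also bounds the earlier weights.
    have hI := ih (by omega) (d ⟨k, hk⟩) fun i hi => hd (Fin.le_def.2 hi.le)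
    have hDk := hD ⟨k, hk⟩ (Nat.lt_succ_self k)
    rw [hins, Finset.sum_insert (by simp)] at hA ⊢
    rw [Finset.sum_insert (by simp)]
    nlinarith [mul_nonpos_of_nonneg_of_nonpos (sub_nonneg.2 hDk) hA]

/-- The tangent at `y` to the convex function `c ^ x` lies below it; this is `1 + u ≤ exp u` with `u
= log c * (x - y)`. -/
theorem pow_tangent_le {c : ℝ} (hc : 0 < c) (x y : ℕ) :
    Real.log c * c ^ y * ((x : ℝ) - y) ≤ c ^ x - c ^ y := by
  have hx : c ^ x = c ^ y * Real.exp (Real.log c * ((x : ℝ) - y)) := by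
    rw [← Real.rpow_natCast c x, ← Real.rpow_natCast c y, ← Real.rpow_def_of_pos hc,
      ← Real.rpow_add hc]
    congr 1; ring
  rw [hx]
  nlinarith [mul_le_mul_of_nonneg_left (Real.add_one_le_exp (Real.log c * ((x : ℝ) - y)))
    (pow_pos hc y).le]

theorem pow_tangent_lt {c : ℝ} (hc : 0 < c) (hc1 : c < 1) {x y : ℕ} (hxy : x ≠ y) :
    Real.log c * c ^ y * ((x : ℝ) - y) < c ^ x - c ^ y := by
  have hx : c ^ x = c ^ y * Real.exp (Real.log c * ((x : ℝ) - y)) := by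
    rw [← Real.rpow_natCast c x, ← Real.rpow_natCast c y, ← Real.rpow_def_of_pos hc,
      ← Real.rpow_add hc]
    congr 1; ring
  have hne : Real.log c * ((x : ℝ) - y) ≠ 0 :=
    mul_ne_zero (Real.log_neg hc hc1).ne (sub_ne_zero.2 (by exact_mod_cast hxy))
  rw [hx]
  nlinarith [mul_lt_mul_of_pos_left (Real.add_one_lt_exp hne) (pow_pos hc y)]

section Schur

variable {p : ℕ} {x y : Fin p → ℕ} {c : ℝ}

/-- Read from the last coordinate, the tangent slopes are increasing and nonpositive, while the
partial sums of `x - y` are nonpositive. Summation by parts with `D = 0` applies. -/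
theorem Majorizes.tangent_sum_nonneg (hx : Antitone x) (hy : Antitone y) (h : Majorizes x y)
    (hc : 0 < c) (hc1 : c ≤ 1) :
    0 ≤ ∑ i, Real.log c * c ^ y i * ((x i : ℝ) - y i) := by
  obtain ⟨hs, ht⟩ := (majorizes_iff_suffixSum hx hy).1 h
  have hlog : Real.log c ≤ 0 := Real.log_nonpos hc.le hc1
  have hcast : ∀ k, ∑ i ∈ Finset.univ.filter (fun i : Fin p => (i : ℕ) < k),
      ((x i.rev : ℝ) - y i.rev) = (suffixSum x k : ℝ) - suffixSum y k := by
    intro k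
    simp [suffixSum, Finset.sum_sub_distrib]
  have key := mul_sum_le_sum_mul_of_partial_sums_nonpos
    (fun i : Fin p => Real.log c * c ^ y i.rev) (fun i => (x i.rev : ℝ) - y i.rev)
    (fun i j hij => mul_le_mul_of_nonpos_left
      (pow_le_pow_of_le_one hc.le hc1 (hy (Fin.rev_le_rev.2 hij))) hlog)
    (fun k hk => by
      rw [hcast, sub_nonpos]
      exact_mod_cast hs k hk) p le_rfl 0
    (fun i _ => mul_nonpos_of_nonpos_of_nonneg hlog (pow_nonneg hc.le _))
  rw [zero_mul, Finset.filter_true_of_mem fun i _ => i.2] at key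
  exact key.trans_eq
    (Equiv.sum_comp Fin.revPerm fun i => Real.log c * c ^ y i * ((x i : ℝ) - y i))

theorem Majorizes.sum_pow_le (hx : Antitone x) (hy : Antitone y) (h : Majorizes x y)
    (hc : 0 < c) (hc1 : c ≤ 1) : ∑ i, c ^ y i ≤ ∑ i, c ^ x i := by
  have h1 := h.tangent_sum_nonneg hx hy hc hc1
  have h2 := Finset.sum_le_sum fun i (_ : i ∈ Finset.univ) => pow_tangent_le hc (x i) (y i)
  rw [Finset.sum_sub_distrib] at h2
  linarith

theorem Majorizes.sum_pow_lt (hx : Antitone x) (hy : Antitone y) (h : Majorizes x y)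
    (hc : 0 < c) (hc1 : c < 1) (hne : x ≠ y) : ∑ i, c ^ y i < ∑ i, c ^ x i := by
  have h1 := h.tangent_sum_nonneg hx hy hc hc1.le
  obtain ⟨j, hj⟩ := Function.ne_iff.1 hne
  have h2 := Finset.sum_lt_sum (fun i (_ : i ∈ Finset.univ) => pow_tangent_le hc (x i) (y i))
    ⟨j, Finset.mem_univ j, pow_tangent_lt hc hc1 hj⟩
  rw [Finset.sum_sub_distrib] at h2
  linarith

end Schur

theorem eq_of_mem_of_eq_one {t m : ℕ} {x : Fin t → ℕ} (hx : x ∈ pathLengthVectors t m)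
    (i j : Fin t) (hi : x i = 1) (hj : x j = 1) : i = j := by
  have h1 := two_le_of_mem hx i
  have h2 := two_le_of_mem hx j
  have := i.2
  have := j.2
  ext
  omega

theorem sum_pow_sub_one {p : ℕ} {x : Fin p → ℕ} (hx : ∀ i, 1 ≤ x i) {c : ℝ} (hc : 0 < c) :
    ∑ i, c ^ (x i - 1) = (∑ i, c ^ x i) * c⁻¹ := by
  rw [Finset.sum_mul]
  exact Finset.sum_congr rfl fun i _ => by rw [pow_sub₀ c hc.ne' (hx i), pow_one]

/-! ### Zeros of the characteristic function -/

section Root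

variable {s t : ℕ} {α : ℝ} {K₁ : Fin s → ℕ} {K₂ : Fin t → ℕ}

theorem thetaChar_one (hα₁ : α < 1) :
    thetaChar α K₁ K₂ 1 = (1 - s * α) * (1 - t * α) - (1 - α) ^ 2 * (s * t) := by
  have : (1 - α) / (1 - α) = 1 := div_self (by linarith)
  simp [thetaChar, this]

theorem sub_natCast_mul_le {n : ℕ} (hn : 1 ≤ n) (hα₀ : 0 ≤ α) : 1 - n * α ≤ 1 - α := by
  have : (1 : ℝ) ≤ n := by exact_mod_cast hn
  nlinarith

/-- If the maximum is 1, then `c = 1` and the two sums are `s` and `t`. Otherwise it is `sα` or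
`tα`, and a factor of the leading product vanishes. -/
theorem thetaChar_max_nonpos (hs : 1 ≤ s) (ht : 1 ≤ t) (hα₀ : 0 ≤ α) (hα₁ : α < 1) :
    thetaChar α K₁ K₂ (max 1 (max (s * α) (t * α))) ≤ 0 := by
  have hs' : (1 : ℝ) ≤ s := by exact_mod_cast hs
  have ht' : (1 : ℝ) ≤ t := by exact_mod_cast ht
  set r := max 1 (max (s * α) (t * α)) with hr
  have hr1 : 1 ≤ r := le_max_left _ _
  have hrs : s * α ≤ r := (le_max_left _ _).trans (le_max_right _ _)
  have hrt : t * α ≤ r := (le_max_right _ _).trans (le_max_right _ _)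
  by_cases h1 : r = 1
  · rw [h1] at hrs hrt ⊢
    rw [thetaChar_one hα₁, sub_nonpos]
    calc (1 - s * α) * (1 - t * α) ≤ (1 - α) * (1 - α) :=
          mul_le_mul (sub_natCast_mul_le hs hα₀) (sub_natCast_mul_le ht hα₀) (by linarith)
            (by linarith)
      _ ≤ (1 - α) ^ 2 * (s * t) := by
          nlinarith [sq_nonneg (1 - α), one_le_mul_of_one_le_of_one_le hs' ht']
  · have hzero : (r - s * α) * (r - t * α) = 0 := by
      obtain h | h := max_choice 1 (max (s * α) (t * α))
      · exact absurd h h1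
      · obtain h' | h' := max_choice (s * α) (t * α)
        · rw [hr, h, h', sub_self, zero_mul]
        · rw [hr, h, h', sub_self, mul_zero]
    have hc : 0 ≤ (1 - α) / (r - α) := div_nonneg (by linarith) (by linarith)
    rw [thetaChar, hzero, zero_sub, neg_nonpos]
    exact mul_nonneg (sq_nonneg _) (mul_nonneg (Finset.sum_nonneg fun i _ => pow_nonneg hc _)
      (Finset.sum_nonneg fun i _ => pow_nonneg hc _))

theorem exists_thetaChar_eq_zero_le (hs : 1 ≤ s) (ht : 1 ≤ t) (hα₀ : 0 ≤ α) (hα₁ : α < 1) {R : ℝ}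
    (hR : max 1 (max (s * α) (t * α)) ≤ R) (hpos : 0 ≤ thetaChar α K₁ K₂ R) :
    ∃ ρ ∈ Set.Icc (max 1 (max (s * α) (t * α))) R, thetaChar α K₁ K₂ ρ = 0 := by
  have hcont : ContinuousOn (thetaChar α K₁ K₂) (Set.Icc (max 1 (max (s * α) (t * α))) R) := by
    have hne : ∀ x ∈ Set.Icc (max 1 (max (s * α) (t * α))) R, x - α ≠ 0 := fun x hx => by
      have := (le_max_left _ _).trans hx.1
      exact (by linarith : 0 < x - α).ne'
    have hc : ContinuousOn (fun x => (1 - α) / (x - α))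
        (Set.Icc (max 1 (max (s * α) (t * α))) R) :=
      continuousOn_const.div (by fun_prop) hne
    unfold thetaChar
    refine ContinuousOn.sub (by fun_prop) (continuousOn_const.mul (ContinuousOn.mul ?_ ?_))
    · exact continuousOn_finsetSum _ fun i _ => hc.pow _
    · exact continuousOn_finsetSum _ fun i _ => hc.pow _
  exact intermediate_value_Icc hR hcont ⟨thetaChar_max_nonpos hs ht hα₀ hα₁, hpos⟩

theorem exists_thetaChar_eq_zero (hs : 1 ≤ s) (ht : 1 ≤ t) (hα₀ : 0 ≤ α) (hα₁ : α < 1) :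
    ∃ ρ, max 1 (max (s * α) (t * α)) ≤ ρ ∧ thetaChar α K₁ K₂ ρ = 0 := by
  have hs' : (1 : ℝ) ≤ s := by exact_mod_cast hs
  have ht' : (1 : ℝ) ≤ t := by exact_mod_cast ht
  have hst : (1 : ℝ) ≤ s * t := by nlinarith
  have hsα : s * α ≤ s := by nlinarith
  have htα : t * α ≤ t := by nlinarith
  -- Chosen so that both linear factors are at least `st`, while the subtracted term is at most
  -- `st`.
  set R : ℝ := s * t + s + t with hR
  obtain ⟨ρ, hρ, h0⟩ := exists_thetaChar_eq_zero_le (K₁ := K₁) (K₂ := K₂) hs ht hα₀ hα₁ (R := R)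
    (max_le (by linarith) (max_le (by linarith) (by linarith))) <| by
      have hc0 : 0 ≤ (1 - α) / (R - α) := div_nonneg (by linarith) (by linarith)
      have hc1 : (1 - α) / (R - α) ≤ 1 := (div_le_one (by linarith)).2 (by linarith)
      have hsum : ∀ {n : ℕ} (K : Fin n → ℕ), ∑ i, ((1 - α) / (R - α)) ^ (K i - 1) ≤ n := by
        intro n K
        calc ∑ i, ((1 - α) / (R - α)) ^ (K i - 1) ≤ ∑ _i : Fin n, (1 : ℝ) :=
              Finset.sum_le_sum fun i _ => pow_le_one₀ hc0 hc1
          _ = n := by simp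
      rw [thetaChar, sub_nonneg]
      calc (1 - α) ^ 2 * ((∑ i, ((1 - α) / (R - α)) ^ (K₁ i - 1)) *
            ∑ j, ((1 - α) / (R - α)) ^ (K₂ j - 1)) ≤ 1 * (s * t) := by
            refine mul_le_mul (pow_le_one₀ (by linarith) (by linarith))
              (mul_le_mul (hsum K₁) (hsum K₂) (Finset.sum_nonneg fun i _ => pow_nonneg hc0 _)
                (by linarith)) ?_ zero_le_one
            exact mul_nonneg (Finset.sum_nonneg fun i _ => pow_nonneg hc0 _)
              (Finset.sum_nonneg fun i _ => pow_nonneg hc0 _)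
        _ ≤ (s * t) * (s * t) := by nlinarith
        _ ≤ (R - s * α) * (R - t * α) :=
            mul_le_mul (by linarith) (by linarith) (by linarith) (by linarith)
  exact ⟨ρ, hρ.1, h0⟩

/-- At 1 the function is at most `(1 - α)² (1 - st) < 0`. Thus `c < 1` at any admissible zero, which
makes Schur-convexity strict. -/
theorem one_lt_of_thetaChar_eq_zero (hs : 1 ≤ s) (ht : 1 ≤ t) (hst : 1 < s * t) (hα₀ : 0 ≤ α)
    (hα₁ : α < 1) {ρ : ℝ} (hρ : max 1 (max (s * α) (t * α)) ≤ ρ)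
    (h : thetaChar α K₁ K₂ ρ = 0) : 1 < ρ := by
  obtain ⟨h1, h2⟩ := max_le_iff.1 hρ
  obtain ⟨hρs, hρt⟩ := max_le_iff.1 h2
  refine lt_of_le_of_ne h1 fun h' => ?_
  subst h'
  rw [thetaChar_one hα₁] at h
  have hst' : (1 : ℝ) < s * t := by exact_mod_cast hst
  have hle : (1 - s * α) * (1 - t * α) ≤ (1 - α) * (1 - α) :=
    mul_le_mul (sub_natCast_mul_le hs hα₀) (sub_natCast_mul_le ht hα₀) (by linarith)
      (by linarith)
  nlinarith [pow_pos (sub_pos.2 hα₁) 2]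

end Root

/-! ### Monotonicity under majorization and the extremal digraphs -/

/-- The α-spectral radius of theta digraphs is strictly monotone for majorization. -/
theorem alphaSpectralRadius_le_of_majorizes {s t m₁ m₂ : ℕ} (hs : 1 ≤ s) (ht : 1 ≤ t) {α : ℝ}
    (hα₀ : 0 ≤ α) (hα₁ : α < 1) {K₁ L₁ : Fin s → ℕ} {K₂ L₂ : Fin t → ℕ}
    (hK₁ : K₁ ∈ pathLengthVectors s m₁) (hL₁ : L₁ ∈ pathLengthVectors s m₁)
    (hK₂ : K₂ ∈ pathLengthVectors t m₂) (hL₂ : L₂ ∈ pathLengthVectors t m₂)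
    (hM₁ : Majorizes K₁ L₁) (hM₂ : Majorizes K₂ L₂) :
    alphaSpectralRadius α (thetaDigraph L₁ L₂) ≤ alphaSpectralRadius α (thetaDigraph K₁ K₂) ∧
      (alphaSpectralRadius α (thetaDigraph L₁ L₂) = alphaSpectralRadius α (thetaDigraph K₁ K₂) →
        K₁ = L₁ ∧ K₂ = L₂) := by
  have radius : ∀ {K : Fin s → ℕ} {K' : Fin t → ℕ}, K ∈ pathLengthVectors s m₁ →
      K' ∈ pathLengthVectors t m₂ → ∀ {r : ℝ}, max 1 (max (s * α) (t * α)) ≤ r →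
      thetaChar α K K' r = 0 →
      alphaSpectralRadius α (thetaDigraph K K') = ENNReal.ofReal r :=
    fun hK hK' _ hr h => alphaSpectralRadius_eq_of_thetaChar_eq_zero hs ht hα₀ hα₁ hK.2.1 hK'.2.1
      (eq_of_mem_of_eq_one hK) (eq_of_mem_of_eq_one hK') (max_le_iff.1 hr).1
      (max_le_iff.1 (max_le_iff.1 hr).2).2 h
  have : Nonempty (Fin s) := ⟨⟨0, hs⟩⟩
  have : Nonempty (Fin t) := ⟨⟨0, ht⟩⟩
  obtain ⟨ρ, hρ, hroot⟩ := exists_thetaChar_eq_zero (K₁ := K₁) (K₂ := K₂) hs ht hα₀ hα₁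
  have hρ1 : 1 ≤ ρ := (max_le_iff.1 hρ).1
  have hα : 0 < 1 - α := sub_pos.2 hα₁
  have hc : 0 < (1 - α) / (ρ - α) := div_pos hα (by linarith)
  have hc1 : (1 - α) / (ρ - α) ≤ 1 := (div_le_one (by linarith)).2 (by linarith)
  have hpos : ∀ {n : ℕ} [Nonempty (Fin n)] (K : Fin n → ℕ),
      0 < ∑ i, ((1 - α) / (ρ - α)) ^ (K i - 1) :=
    fun K => Finset.sum_pos (fun i _ => pow_pos hc _) Finset.univ_nonempty
  have hle : ∀ {n m : ℕ} {x y : Fin n → ℕ}, x ∈ pathLengthVectors n m →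
      y ∈ pathLengthVectors n m → Majorizes x y →
      ∑ i, ((1 - α) / (ρ - α)) ^ (y i - 1) ≤ ∑ i, ((1 - α) / (ρ - α)) ^ (x i - 1) := by
    intro n m x y hx hy h
    rw [sum_pow_sub_one hx.2.1 hc, sum_pow_sub_one hy.2.1 hc]
    exact mul_le_mul_of_nonneg_right (h.sum_pow_le hx.1 hy.1 hc hc1) (inv_nonneg.2 hc.le)
  have hlt : ∀ {n m : ℕ} {x y : Fin n → ℕ}, x ∈ pathLengthVectors n m →
      y ∈ pathLengthVectors n m → Majorizes x y → 1 < ρ → x ≠ y →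
      ∑ i, ((1 - α) / (ρ - α)) ^ (y i - 1) < ∑ i, ((1 - α) / (ρ - α)) ^ (x i - 1) := by
    intro n m x y hx hy h hρ' hne
    rw [sum_pow_sub_one hx.2.1 hc, sum_pow_sub_one hy.2.1 hc]
    exact mul_lt_mul_of_pos_right
      (h.sum_pow_lt hx.1 hy.1 hc ((div_lt_one (by linarith)).2 (by linarith)) hne)
      (inv_pos.2 hc)
  -- Both functions share the leading product, and the subtracted term is smaller for `L`.
  have hL : 0 ≤ thetaChar α L₁ L₂ ρ := by
    rw [← hroot]
    exact sub_le_sub_left (mul_le_mul_of_nonneg_left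
      (mul_le_mul (hle hK₁ hL₁ hM₁) (hle hK₂ hL₂ hM₂) (hpos L₂).le (hpos K₁).le)
      (sq_nonneg _)) _
  obtain ⟨ρ', hρ', hroot'⟩ := exists_thetaChar_eq_zero_le hs ht hα₀ hα₁ hρ hL
  rw [radius hK₁ hK₂ hρ hroot, radius hL₁ hL₂ hρ'.1 hroot']
  refine ⟨ENNReal.ofReal_le_ofReal hρ'.2, fun heq => ?_⟩
  have hρρ : ρ' = ρ := (ENNReal.ofReal_eq_ofReal_iff
    (zero_le_one.trans ((le_max_left _ _).trans hρ'.1)) (by linarith)).1 heq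
  subst hρρ
  have hprod : (∑ i, ((1 - α) / (ρ' - α)) ^ (L₁ i - 1)) * ∑ j, ((1 - α) / (ρ' - α)) ^ (L₂ j - 1) =
      (∑ i, ((1 - α) / (ρ' - α)) ^ (K₁ i - 1)) * ∑ j, ((1 - α) / (ρ' - α)) ^ (K₂ j - 1) :=
    mul_left_cancel₀ (pow_pos hα 2).ne' (sub_right_injective (hroot'.trans hroot.symm))
  by_cases hst : 1 < s * t
  · have hρ1' := one_lt_of_thetaChar_eq_zero hs ht hst hα₀ hα₁ hρ hroot
    constructor <;> by_contra hne
    · exact hprod.not_lt (mul_lt_mul (hlt hK₁ hL₁ hM₁ hρ1' hne) (hle hK₂ hL₂ hM₂) (hpos L₂)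
        (hpos K₁).le)
    · exact hprod.not_lt (mul_lt_mul' (hle hK₁ hL₁ hM₁) (hlt hK₂ hL₂ hM₂ hρ1' hne) (hpos L₂).le
        (hpos K₁))
  -- The digraph is a directed cycle and strictness is unavailable, but a vector of length 1 is its
  -- sum.
  · obtain rfl : s = 1 := by nlinarith
    obtain rfl : t = 1 := by nlinarith
    have e₁ := hM₁.2
    have e₂ := hM₂.2
    simp only [Fin.sum_univ_one] at e₁ e₂
    exact ⟨funext fun i => by rw [Subsingleton.elim i 0, e₁],
      funext fun i => by rw [Subsingleton.elim i 0, e₂]⟩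

theorem mainTheorem4 (s t m₁ m₂ : ℕ) (hs : 1 ≤ s) (ht : 1 ≤ t)
    (hm₁ : 2 * s - 1 ≤ m₁) (hm₂ : 2 * t - 1 ≤ m₂)
    (α : ℝ) (hα₀ : 0 ≤ α) (hα₁ : α < 1) :
    -- the extremal vectors are the extrema of the two sets in the majorization order
    (IsMajGreatest (pathLengthVectors s m₁) (majMaxVec s m₁) ∧
      IsMajGreatest (pathLengthVectors t m₂) (majMaxVec t m₂) ∧
      IsMajLeast (pathLengthVectors s m₁) (majMinVec s m₁) ∧
      IsMajLeast (pathLengthVectors t m₂) (majMinVec t m₂)) ∧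
    -- unique maximum of the α-spectral radius
    (∀ K₁ ∈ pathLengthVectors s m₁, ∀ K₂ ∈ pathLengthVectors t m₂,
      alphaSpectralRadius α (thetaDigraph K₁ K₂) ≤
          alphaSpectralRadius α (thetaDigraph (majMaxVec s m₁) (majMaxVec t m₂)) ∧
        (alphaSpectralRadius α (thetaDigraph K₁ K₂) =
            alphaSpectralRadius α (thetaDigraph (majMaxVec s m₁) (majMaxVec t m₂)) ↔
          K₁ = majMaxVec s m₁ ∧ K₂ = majMaxVec t m₂)) ∧
    -- unique minimum of the α-spectral radius
    (∀ K₁ ∈ pathLengthVectors s m₁, ∀ K₂ ∈ pathLengthVectors t m₂,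
      alphaSpectralRadius α (thetaDigraph (majMinVec s m₁) (majMinVec t m₂)) ≤
          alphaSpectralRadius α (thetaDigraph K₁ K₂) ∧
        (alphaSpectralRadius α (thetaDigraph K₁ K₂) =
            alphaSpectralRadius α (thetaDigraph (majMinVec s m₁) (majMinVec t m₂)) ↔
          K₁ = majMinVec s m₁ ∧ K₂ = majMinVec t m₂)) := by
  have hg₁ := isMajGreatest_majMaxVec hs hm₁
  have hg₂ := isMajGreatest_majMaxVec ht hm₂
  have hl₁ := isMajLeast_majMinVec hs hm₁
  have hl₂ := isMajLeast_majMinVec ht hm₂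
  refine ⟨⟨hg₁, hg₂, hl₁, hl₂⟩, fun K₁ hK₁ K₂ hK₂ => ?_, fun K₁ hK₁ K₂ hK₂ => ?_⟩
  · obtain ⟨hle, heq⟩ := alphaSpectralRadius_le_of_majorizes hs ht hα₀ hα₁ hg₁.1 hK₁ hg₂.1 hK₂
      (hg₁.2 K₁ hK₁) (hg₂.2 K₂ hK₂)
    refine ⟨hle, fun h => ⟨(heq h).1.symm, (heq h).2.symm⟩, ?_⟩
    rintro ⟨rfl, rfl⟩
    rfl
  · obtain ⟨hle, heq⟩ := alphaSpectralRadius_le_of_majorizes hs ht hα₀ hα₁ hK₁ hl₁.1 hK₂ hl₂.1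
      (hl₁.2 K₁ hK₁) (hl₂.2 K₂ hK₂)
    refine ⟨hle, fun h => heq h.symm, ?_⟩
    rintro ⟨rfl, rfl⟩
    rfl
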